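/- Let $n\ge 1$ and $r\ge 0$ be integers and let $\mathfrak g=\mathfrak{sp}(2n,\mathbb C)$ be the Lie algebra of block matrices $\begin{pmatrix}A&X\\Y&-{}^{\top}\!A\end{pmatrix}$ with $A,X,Y\in\mathrm{Mat}_n(\mathbb C)$ and $X,Y$ symmetric. Let $V$ be a $U(\mathfrak g)$-module. A vector $v\in V$ satisfies (Hol) if $$\begin{pmatrix}0&0\\X&0\end{pmatrix}v=0\quad\text{for all symmetric }X\in\mathrm{Mat}_n(\mathbb C),$$ and, for $k\in\mathbb C$, it satisfies (Weight $k$) if $$\begin{pmatrix}A&0\\0&-{}^{\top}\!A\end{pmatrix}v=k\,\mathrm{Tr}(A)\,v\quad\text{for all }A\in\mathfrak{gl}(n,\mathbb C).$$ For $1\le i,j\le n$ let $\hat R_{ij}=\begin{pmatrix}0&E_{ij}+E_{ji}\\0&0\end{pmatrix}\in\mathfrak g$, where $E_{ij}$ is the matrix unit. These elements commute in $U(\mathfrak g)$; put $\hat M_+=\det(\hat R_{ij})_{1\le i,j\le n}\in U(\mathfrak g)$. Suppose that $v_0\in V$ satisfies (Hol) and (Weight $-r+\frac{n-1}{2}$).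 Then $\hat M_+^{\,r+1}v_0$ satisfies (Hol) and (Weight $r+2+\frac{n-1}{2}$). Moreover, if $k\ge 1$ is an integer with $k\ne r+1$ and $\hat M_+^{\,k}v_0\neq 0$, then $\hat M_+^{\,k}v_0$ does not satisfy (Hol). -/

import Mathlib

attribute [local instance 100] LieRing.ofAssociativeRing

namespace SiegelSp

open Matrix

/-- The complex symplectic Lie algebra `sp(2n, ℂ)`: block matrices `(A, X; Y, -Aᵀ)` with `X`, `Y`
symmetric, inside the `2n × 2n` complex matrices. -/
abbrev SpLie (n : ℕ) : LieSubalgebra ℂ (Matrix (Fin n ⊕ Fin n) (Fin n ⊕ Fin n) ℂ) :=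
  LieAlgebra.Symplectic.sp (Fin n) ℂ

/-- The universal enveloping algebra `U(sp(2n, ℂ))`. -/
abbrev USp (n : ℕ) : Type := UniversalEnvelopingAlgebra ℂ (SpLie n)

/-- The inclusion of `sp(2n, ℂ)` into its universal enveloping algebra. -/
abbrev toUSp {n : ℕ} (x : SpLie n) : USp n := UniversalEnvelopingAlgebra.ι ℂ x

theorem levi_mem {n : ℕ} (A : Matrix (Fin n) (Fin n) ℂ) :
    fromBlocks A 0 0 (-Aᵀ) ∈ SpLie n := by
  simp [SpLie, LieAlgebra.Symplectic.sp, Matrix.IsSkewAdjoint, Matrix.IsAdjointPair, Matrix.J,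
    fromBlocks_multiply, fromBlocks_transpose, fromBlocks_neg]

theorem upper_mem {n : ℕ} {X : Matrix (Fin n) (Fin n) ℂ} (hX : X.IsSymm) :
    fromBlocks 0 X 0 0 ∈ SpLie n := by
  simp [SpLie, LieAlgebra.Symplectic.sp, Matrix.IsSkewAdjoint, Matrix.IsAdjointPair, Matrix.J,
    fromBlocks_multiply, fromBlocks_transpose, fromBlocks_neg, hX.eq]

theorem lower_mem {n : ℕ} {X : Matrix (Fin n) (Fin n) ℂ} (hX : X.IsSymm) :
    fromBlocks 0 0 X 0 ∈ SpLie n := by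
  simp [SpLie, LieAlgebra.Symplectic.sp, Matrix.IsSkewAdjoint, Matrix.IsAdjointPair, Matrix.J,
    fromBlocks_multiply, fromBlocks_transpose, fromBlocks_neg, hX.eq]

/-- The element `(A, 0; 0, -Aᵀ)` of `sp(2n, ℂ)`. -/
def levi {n : ℕ} (A : Matrix (Fin n) (Fin n) ℂ) : SpLie n :=
  ⟨fromBlocks A 0 0 (-Aᵀ), levi_mem A⟩

/-- The element `(0, X; 0, 0)` of `sp(2n, ℂ)`, for `X` symmetric. -/
def upper {n : ℕ} (X : Matrix (Fin n) (Fin n) ℂ) (hX : X.IsSymm) : SpLie n :=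
  ⟨fromBlocks 0 X 0 0, upper_mem hX⟩

/-- The element `(0, 0; X, 0)` of `sp(2n, ℂ)`, for `X` symmetric. -/
def lower {n : ℕ} (X : Matrix (Fin n) (Fin n) ℂ) (hX : X.IsSymm) : SpLie n :=
  ⟨fromBlocks 0 0 X 0, lower_mem hX⟩

/-- The symmetric matrix `E_{ij} + E_{ji}`; in particular it is `2 E_{ii}` when `i = j`. -/
def symmUnit {n : ℕ} (i j : Fin n) : Matrix (Fin n) (Fin n) ℂ :=
  Matrix.single i j 1 + Matrix.single j i 1

theorem symmUnit_isSymm {n : ℕ} (i j : Fin n) : (symmUnit i j).IsSymm := by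
  simp [symmUnit, Matrix.IsSymm, add_comm]

/-- The `(i, j)` entry of the matrix of raising operators: the element
`(0, E_{ij} + E_{ji}; 0, 0)` of `sp(2n, ℂ)`, regarded in `U(sp(2n, ℂ))`. -/
def raising {n : ℕ} (i j : Fin n) : USp n :=
  toUSp (upper (symmUnit i j) (symmUnit_isSymm i j))

/-- The raising operators commute, so that the order of the factors in a determinant of raising
operators does not matter. -/
theorem raising_commute {n : ℕ} (i j k l : Fin n) :
    Commute (raising i j) (raising k l) := by
  have h : ⁅upper (symmUnit i j) (symmUnit_isSymm i j),
      upper (symmUnit k l) (symmUnit_isSymm k l)⁆ = 0 := by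
    apply Subtype.ext
    simp [upper, Ring.lie_def, fromBlocks_multiply]
  have h2 := LieHom.map_lie (UniversalEnvelopingAlgebra.ι ℂ (L := SpLie n))
    (upper (symmUnit i j) (symmUnit_isSymm i j)) (upper (symmUnit k l) (symmUnit_isSymm k l))
  rw [h, map_zero, Ring.lie_def] at h2
  exact (sub_eq_zero.mp h2.symm)

/-- The operator `M̂₊ ∈ U(sp(2n, ℂ))`: the determinant of the `n × n` matrix of (commuting) raising
operators, written out by the Leibniz formula. -/
noncomputable def raisingDet (n : ℕ) : USp n :=
  ∑ σ : Equiv.Perm (Fin n),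
    ((Equiv.Perm.sign σ : ℤˣ) : ℤ) • (List.ofFn fun i : Fin n => raising (σ i) i).prod

/-- `raisingDet` is the usual determinant, computed in any commutative ring that maps to
`U(sp(2n, ℂ))` and contains lifts of the raising operators. -/
theorem raisingDet_eq_map_det {n : ℕ} {A : Type*} [CommRing A] (f : A →+* USp n)
    (M : Matrix (Fin n) (Fin n) A) (hM : ∀ i j, f (M i j) = raising i j) :
    raisingDet n = f M.det := by
  rw [Matrix.det_apply, map_sum]
  refine Finset.sum_congr rfl fun σ _ => ?_
  rw [Units.smul_def, map_zsmul, ← List.prod_ofFn, map_list_prod, List.map_ofFn]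
  congr 3
  funext i
  exact (hM _ _).symm

/-- `v` is holomorphic: `(0, 0; X, 0) v = 0` for every symmetric `X`. -/
def IsHol {n : ℕ} {V : Type*} [AddCommGroup V] [Module (USp n) V] (v : V) : Prop :=
  ∀ (X : Matrix (Fin n) (Fin n) ℂ) (hX : X.IsSymm), toUSp (lower X hX) • v = 0

/-- `v` has weight `k`: `(A, 0; 0, -Aᵀ) v = k Tr(A) v` for every `A ∈ gl(n, ℂ)`. Complex scalars act
on a `U(sp(2n, ℂ))`-module through `ℂ → U(sp(2n, ℂ))`. -/
def HasWeight {n : ℕ} {V : Type*} [AddCommGroup V] [Module (USp n) V] (k : ℂ) (v : V) : Prop :=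
  ∀ A : Matrix (Fin n) (Fin n) ℂ,
    toUSp (levi A) • v = algebraMap ℂ (USp n) (k * A.trace) • v

end SiegelSp

/-!
Write `M` for `raisingDet n`, and for symmetric `Y` let `C(Y) = tr(adj(R) Y)`, where `R` is the
symmetric matrix of raising operators. The entries of `R` commute, so `M`, `adj(R)` and `C(Y)`
all live in a commutative subalgebra of `U(sp(2n, ℂ))`; below, `f : A → U(sp(2n, ℂ))` is a
homomorphism from a commutative algebra over which `R` is defined.

* Levi elements act on `R` by `[levi B, R] = Bᵀ R + R B`, so `[levi B, M] = 2 tr(B) M`, and `M`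
  raises the weight by `2`.
* On a vector `v` of weight `κ`, `[lower Y, M] v = (n - 1 - 2κ) C(Y) v`
  (`lie_lower_raisingDet_smul`). Indeed, `[lower Y, ·]` acts on polynomials in `R` as a second
  order differential operator (`two_mul_lie_map_prod`): its first order part involves Levi
  elements, which act on `v` through `κ` and contribute `-2κ C(Y)`; its second order part, applied
  to the determinant, is `(n - 1) C(Y)` by antisymmetry (`sum_sign_mul_pair`).
* Therefore, for `v` holomorphic of weight `κ`, induction on `k` gives
  `lower Y · M ^ (k + 1) v = (k + 1) (n - 1 - 2κ - 2k) C(Y) M ^ k v`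
  (`lower_smul_raisingDet_pow_smul`). For `κ = -r + (n - 1) / 2` the scalar is
  `2 (k + 1) (r - k)`, which vanishes exactly for `k = r`.
* If the scalar does not vanish and `M ^ (k + 1) v` is holomorphic, then `C(Y) M ^ k v = 0` for all
  symmetric `Y`, so all entries of `adj(R)` annihilate `M ^ k v`; by expansion along a row so does
  `M = det R`, that is, `M ^ (k + 1) v = 0` (`raisingDet_smul_eq_zero`).
-/

namespace SiegelSp

open Matrix

/-! ### Commutators with products of commuting elements -/

section Leibniz

variable {A U ι : Type*} [CommRing A] [Ring U] [DecidableEq ι]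

theorem lie_mul_eq (l x y : U) : ⁅l, x * y⁆ = ⁅l, x⁆ * y + x * ⁅l, y⁆ := by
  simp only [Ring.lie_def]; noncomm_ring

theorem lie_map_prod (f : A →+* U) (l : U) (x y : ι → A) (h : ∀ a, ⁅l, f (x a)⁆ = f (y a))
    (s : Finset ι) :
    ⁅l, f (∏ i ∈ s, x i)⁆ = f (∑ a ∈ s, y a * ∏ i ∈ s.erase a, x i) := by
  induction s using Finset.induction_on with
  | empty => simp [Ring.lie_def]
  | insert c s hc ih =>
    have h1 : ∀ a ∈ s, y a * ∏ i ∈ (insert c s).erase a, x i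
        = x c * (y a * ∏ i ∈ s.erase a, x i) := by
      intro a ha
      rw [Finset.erase_insert_of_ne (by rintro rfl; exact hc ha),
        Finset.prod_insert (by simp [hc])]
      ring
    rw [Finset.prod_insert hc, Finset.sum_insert hc, Finset.erase_insert hc,
      Finset.sum_congr rfl h1, ← Finset.mul_sum, map_mul, lie_mul_eq, ih, h, map_add, map_mul,
      map_mul]

/-- The Leibniz rule for `[l, ·]` on a product of commuting elements `f (x i)`, with all the
commutators `[l, f (x a)]` moved to the right. The double commutators `f (β a b)` that this
produces are symmetric in `a` and `b`; summing them over ordered pairs accounts for the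
factor `2`. -/
theorem two_mul_lie_map_prod (f : A →+* U) (l : U) (x : ι → A) (β : ι → ι → A)
    (hβ : ∀ a b, ⁅⁅l, f (x a)⁆, f (x b)⁆ = f (β a b)) (hs : ∀ a b, β a b = β b a)
    (s : Finset ι) :
    2 * ⁅l, f (∏ i ∈ s, x i)⁆ =
      2 * ∑ a ∈ s, f (∏ i ∈ s.erase a, x i) * ⁅l, f (x a)⁆ +
        f (∑ a ∈ s, ∑ b ∈ s.erase a, β a b * ∏ i ∈ (s.erase a).erase b, x i) := by
  induction s using Finset.induction_on with
  | empty => simp [Ring.lie_def]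
  | insert c s hc ih =>
    have hne : ∀ a ∈ s, c ≠ a := by rintro a ha rfl; exact hc ha
    have h1 : ∀ a ∈ s, f (∏ i ∈ (insert c s).erase a, x i) * ⁅l, f (x a)⁆
        = f (∏ i ∈ s.erase a, x i) * ⁅l, f (x a)⁆ * f (x c)
          - f (β c a * ∏ i ∈ s.erase a, x i) := by
      intro a ha
      rw [Finset.erase_insert_of_ne (hne a ha), Finset.prod_insert (by simp [hc]), hs c a,
        mul_comm (x c), mul_comm (β a c), map_mul, map_mul, ← hβ, Ring.lie_def ⁅l, f (x a)⁆]
      noncomm_ring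
    have h2 : ∀ a ∈ s, ∑ b ∈ (insert c s).erase a,
          β a b * ∏ i ∈ ((insert c s).erase a).erase b, x i
        = β c a * ∏ i ∈ s.erase a, x i
          + (∑ b ∈ s.erase a, β a b * ∏ i ∈ (s.erase a).erase b, x i) * x c := by
      intro a ha
      have hc' : c ∉ s.erase a := by simp [hc]
      rw [Finset.erase_insert_of_ne (hne a ha), Finset.sum_insert hc', Finset.erase_insert hc',
        hs c a, Finset.sum_mul]
      congr 1
      refine Finset.sum_congr rfl fun b hb => ?_
      rw [Finset.erase_insert_of_ne (hne b (Finset.mem_of_mem_erase hb)),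
        Finset.prod_insert (by simp [hc])]
      ring
    rw [Finset.prod_insert hc, mul_comm (x c), map_mul, lie_mul_eq, mul_add, ← mul_assoc, ih,
      Finset.sum_insert hc, Finset.sum_insert hc, Finset.erase_insert hc,
      Finset.sum_congr rfl h1, Finset.sum_congr rfl h2, Finset.sum_sub_distrib,
      Finset.sum_add_distrib, ← Finset.sum_mul, ← Finset.sum_mul]
    simp only [map_add, map_sum, map_mul]
    noncomm_ring

end Leibniz

/-! ### Polarized Leibniz expansions of the determinant -/

section Determinant

variable {A ι : Type*} [CommRing A] [Fintype ι] [DecidableEq ι]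

/-- Both sides are the determinant of `R` with column `a` replaced by column `a` of `Y`. -/
theorem sum_sign_mul_prod_erase (R Y : Matrix ι ι A) (a : ι) :
    ∑ σ : Equiv.Perm ι, ((Equiv.Perm.sign σ : ℤˣ) : ℤ) •
        (Y (σ a) a * ∏ i ∈ Finset.univ.erase a, R (σ i) i) = (R.adjugate * Y) a a := by
  have : (R.adjugate * Y) a a = (R.updateCol a (fun i => Y i a)).det := by
    rw [← cramer_apply, cramer_eq_adjugate_mulVec]; rfl
  rw [this, det_apply]
  refine Finset.sum_congr rfl fun σ _ => ?_
  rw [Units.smul_def, ← Finset.mul_prod_erase _ _ (Finset.mem_univ a), updateCol_self]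
  congr 2
  refine Finset.prod_congr rfl fun i hi => ?_
  rw [updateCol_ne (Finset.ne_of_mem_erase hi)]

theorem trace_adjugate_mul_eq_sum (R Y : Matrix ι ι A) :
    (R.adjugate * Y).trace = ∑ σ : Equiv.Perm ι, ((Equiv.Perm.sign σ : ℤˣ) : ℤ) •
      ∑ a, (Y (σ a) a * ∏ i ∈ Finset.univ.erase a, R (σ i) i) := by
  simp only [Finset.smul_sum]
  rw [Finset.sum_comm]
  simp only [sum_sign_mul_prod_erase, trace, diag_apply]

/-- Exchanging the values of `σ` at `a` and `b` reverses the sign and leaves the product over the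
remaining columns alone. Hence the two middle terms, symmetric in `σ a` and `σ b`, cancel, and
the outer two turn into terms of the determinants of `R` with column `a` or `b` replaced by
that of `Y`. -/
theorem sum_sign_mul_pair (R Y : Matrix ι ι A) (hR : R.IsSymm) (hY : Y.IsSymm) {a b : ι}
    (hab : a ≠ b) :
    ∑ σ : Equiv.Perm ι, ((Equiv.Perm.sign σ : ℤˣ) : ℤ) •
        (-(Y a (σ b) * R (σ a) b + Y (σ a) (σ b) * R a b + R (σ b) (σ a) * Y a b
            + R (σ b) a * Y (σ a) b) *
          ∏ i ∈ (Finset.univ.erase a).erase b, R (σ i) i) =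
      (R.adjugate * Y) a a + (R.adjugate * Y) b b := by
  rw [← sum_sign_mul_prod_erase, ← sum_sign_mul_prod_erase, ← Finset.sum_add_distrib,
    ← sub_eq_zero, ← Finset.sum_sub_distrib]
  refine Finset.sum_involution (fun σ _ => σ * Equiv.swap a b) ?_ ?_ (fun _ _ => Finset.mem_univ _)
    (fun σ _ => by simp [mul_assoc])
  · intro σ _
    have hP : ∏ i ∈ (Finset.univ.erase a).erase b, R ((σ * Equiv.swap a b) i) i
        = ∏ i ∈ (Finset.univ.erase a).erase b, R (σ i) i := by
      refine Finset.prod_congr rfl fun i hi => ?_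
      simp only [Finset.mem_erase] at hi
      rw [Equiv.Perm.mul_apply, Equiv.swap_apply_of_ne_of_ne hi.2.1 hi.1]
    have ha : ∀ τ : Equiv.Perm ι, ∏ i ∈ Finset.univ.erase a, R (τ i) i
        = R (τ b) b * ∏ i ∈ (Finset.univ.erase a).erase b, R (τ i) i := fun τ =>
      (Finset.mul_prod_erase _ _ (by simp [hab.symm])).symm
    have hb : ∀ τ : Equiv.Perm ι, ∏ i ∈ Finset.univ.erase b, R (τ i) i
        = R (τ a) a * ∏ i ∈ (Finset.univ.erase a).erase b, R (τ i) i := fun τ => by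
      rw [Finset.erase_right_comm]
      exact (Finset.mul_prod_erase _ _ (by simp [hab])).symm
    simp only [ha, hb, hP]
    simp only [Equiv.Perm.sign_mul, Equiv.Perm.sign_swap hab, Equiv.Perm.mul_apply,
      Equiv.swap_apply_left, Equiv.swap_apply_right]
    rw [hY.apply (σ a) a, hY.apply (σ b) a, hY.apply (σ a) (σ b), hR.apply (σ a) (σ b)]
    simp only [mul_neg, mul_one, Units.val_neg, neg_smul, zsmul_eq_mul]
    ring
  · intro σ _ _ h
    have := mul_eq_left.mp h
    exact hab (Equiv.swap_eq_one_iff.mp this)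

/-- The sum of `sum_sign_mul_pair` over all ordered pairs: each column occurs in
`2 (card ι - 1)` of them. -/
theorem sum_sign_mul_pairs (R Y : Matrix ι ι A) (hR : R.IsSymm) (hY : Y.IsSymm) :
    ∑ σ : Equiv.Perm ι, ((Equiv.Perm.sign σ : ℤˣ) : ℤ) •
        ∑ a, ∑ b ∈ Finset.univ.erase a,
        (-(Y a (σ b) * R (σ a) b + Y (σ a) (σ b) * R a b + R (σ b) (σ a) * Y a b
            + R (σ b) a * Y (σ a) b) *
          ∏ i ∈ (Finset.univ.erase a).erase b, R (σ i) i) =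
      2 * ((Fintype.card ι - 1) * (R.adjugate * Y).trace) := by
  simp only [Finset.smul_sum]
  rw [Finset.sum_comm]
  have h : ∀ a, ∑ σ : Equiv.Perm ι, ∑ b ∈ Finset.univ.erase a,
        ((Equiv.Perm.sign σ : ℤˣ) : ℤ) •
        (-(Y a (σ b) * R (σ a) b + Y (σ a) (σ b) * R a b + R (σ b) (σ a) * Y a b
            + R (σ b) a * Y (σ a) b) *
          ∏ i ∈ (Finset.univ.erase a).erase b, R (σ i) i) =
      Fintype.card ι * (R.adjugate * Y) a a + (R.adjugate * Y).trace
        - 2 * (R.adjugate * Y) a a := by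
    intro a
    rw [Finset.sum_comm, Finset.sum_congr rfl fun b hb =>
      sum_sign_mul_pair R Y hR hY (Finset.ne_of_mem_erase hb).symm,
      Finset.sum_erase_eq_sub (Finset.mem_univ a)]
    simp [Finset.sum_add_distrib, trace]
    ring
  rw [Finset.sum_congr rfl fun a _ => h a, Finset.sum_sub_distrib, Finset.sum_add_distrib,
    ← Finset.mul_sum, ← Finset.mul_sum]
  simp [trace]
  ring

end Determinant

/-! ### Brackets of Levi, lowering and raising operators -/

section Brackets

variable {n : ℕ}

theorem lie_toUSp (x y : SpLie n) : ⁅toUSp x, toUSp y⁆ = toUSp ⁅x, y⁆ :=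
  (LieHom.map_lie (UniversalEnvelopingAlgebra.ι ℂ (L := SpLie n)) x y).symm

theorem lie_lower_raising (Y : Matrix (Fin n) (Fin n) ℂ) (hY : Y.IsSymm) (i j : Fin n) :
    ⁅toUSp (lower Y hY), raising i j⁆ = -toUSp (levi (symmUnit i j * Y)) := by
  have : ⁅lower Y hY, upper (symmUnit i j) (symmUnit_isSymm i j)⁆
      = -levi (symmUnit i j * Y) := by
    apply Subtype.ext
    simp [lower, upper, levi, Ring.lie_def, fromBlocks_multiply, hY.eq,
      (symmUnit_isSymm i j).eq, fromBlocks_neg, sub_eq_add_neg, fromBlocks_add]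
  rw [raising, lie_toUSp, this, toUSp, map_neg]

/-- In matrix form: `[levi B, R] = Bᵀ R + R B`, for `R` the matrix of raising operators. -/
theorem lie_levi_raising (B : Matrix (Fin n) (Fin n) ℂ) (i j : Fin n) :
    ⁅toUSp (levi B), raising i j⁆ =
      ∑ k, B k i • raising k j + ∑ k, B k j • raising i k := by
  have : ⁅levi B, upper (symmUnit i j) (symmUnit_isSymm i j)⁆ =
      ∑ k, B k i • upper (symmUnit k j) (symmUnit_isSymm k j)
        + ∑ k, B k j • upper (symmUnit i k) (symmUnit_isSymm i k) := by
    apply Subtype.ext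
    have hX : B * symmUnit i j + symmUnit i j * Bᵀ
        = ∑ k, B k i • symmUnit k j + ∑ k, B k j • symmUnit i k := by
      ext x y
      simp [symmUnit, Matrix.mul_apply, Matrix.add_apply, Matrix.sum_apply, Matrix.single_apply,
        mul_add, add_mul, Finset.sum_add_distrib, ite_and]
      split_ifs <;> ring
    have : ((⁅levi B, upper (symmUnit i j) (symmUnit_isSymm i j)⁆ : SpLie n) :
        Matrix (Fin n ⊕ Fin n) (Fin n ⊕ Fin n) ℂ)
        = fromBlocks 0 (B * symmUnit i j + symmUnit i j * Bᵀ) 0 0 := by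
      simp [upper, levi, Ring.lie_def, fromBlocks_multiply, sub_eq_add_neg, fromBlocks_neg,
        fromBlocks_add]
    rw [this, hX]
    ext (x | x) (y | y) <;> simp [upper, Matrix.sum_apply]
  rw [raising, lie_toUSp, this, toUSp, map_add, map_sum, map_sum]
  simp only [map_smul]
  rfl

theorem raising_comm (i j : Fin n) : raising i j = raising j i := by
  have : symmUnit i j = symmUnit j i := add_comm _ _
  simp only [raising, this]

/-- The raising operators generate a commutative subalgebra of `U(sp(2n, ℂ))`, so that the matrix
of raising operators lifts to a symmetric matrix over a commutative ring. -/
theorem exists_commutative_lift (n : ℕ) :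
    ∃ (A : Type) (_ : CommRing A) (_ : Algebra ℂ A) (f : A →ₐ[ℂ] USp n)
      (R : Matrix (Fin n) (Fin n) A), R.IsSymm ∧ ∀ i j, f (R i j) = raising i j := by
  let s : Set (USp n) := Set.range fun p : Fin n × Fin n => raising p.1 p.2
  have hs : ∀ a ∈ s, ∀ b ∈ s, a * b = b * a := by
    rintro _ ⟨p, rfl⟩ _ ⟨q, rfl⟩
    exact raising_commute _ _ _ _
  have := Algebra.isMulCommutative_adjoin ℂ hs
  refine ⟨Algebra.adjoin ℂ s, { (Algebra.adjoin ℂ s).toRing with mul_comm := this.is_comm.comm },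
    (Algebra.adjoin ℂ s).algebra, (Algebra.adjoin ℂ s).val,
    fun i j => ⟨raising i j, Algebra.subset_adjoin ⟨(i, j), rfl⟩⟩, ?_, fun i j => rfl⟩
  ext i j
  exact raising_comm j i

end Brackets

/-! ### Powers of the determinant acting on weight vectors -/

section Action

variable {n : ℕ} {A : Type*} [CommRing A] [Algebra ℂ A] (f : A →ₐ[ℂ] USp n)
  {R : Matrix (Fin n) (Fin n) A}

/-- The derivative of the determinant in the direction `Bᵀ R + R B` is
`tr(adj(R) (Bᵀ R + R B)) = 2 tr(B) det R`. -/
theorem lie_levi_raisingDet (hf : ∀ i j, f (R i j) = raising i j)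
    (B : Matrix (Fin n) (Fin n) ℂ) :
    ⁅toUSp (levi B), f R.det⁆ = f (algebraMap ℂ A (2 * B.trace) * R.det) := by
  set b : Matrix (Fin n) (Fin n) A := B.map (algebraMap ℂ A)
  have h : ∀ i j, ⁅toUSp (levi B), f (R i j)⁆ = f ((bᵀ * R + R * b) i j) := by
    intro i j
    have e : (bᵀ * R + R * b) i j = ∑ k, B k i • R k j + ∑ k, B k j • R i k := by
      simp [b, Matrix.mul_apply, Algebra.smul_def, mul_comm]
    rw [hf, lie_levi_raising, e]
    simp only [map_add, map_sum, map_smul, hf]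
  have htr : (R.adjugate * (bᵀ * R + R * b)).trace = algebraMap ℂ A (2 * B.trace) * R.det := by
    have hb : b.trace = algebraMap ℂ A B.trace := by simp [b, trace]
    rw [mul_add, trace_add, trace_mul_comm, Matrix.mul_assoc, mul_adjugate, ← Matrix.mul_assoc,
      adjugate_mul]
    simp [hb, trace_transpose, map_ofNat]
    ring
  rw [← htr, trace_adjugate_mul_eq_sum, det_apply, map_sum, map_sum, lie_sum]
  refine Finset.sum_congr rfl fun σ _ => ?_
  rw [Units.smul_def, map_zsmul, map_zsmul, lie_zsmul]
  congr 1
  exact lie_map_prod f.toRingHom _ _ (fun a => (bᵀ * R + R * b) (σ a) a) (fun a => h _ _) _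

theorem symmUnit_mul_apply (i j : Fin n) (Y : Matrix (Fin n) (Fin n) ℂ) (p k : Fin n) :
    (symmUnit i j * Y) p k = (if p = i then Y j k else 0) + if p = j then Y i k else 0 := by
  simp [symmUnit, add_mul, Matrix.mul_apply, Matrix.single_apply, ite_and,
    Finset.sum_add_distrib, eq_comm]

theorem lie_lie_lower_raising (hf : ∀ i j, f (R i j) = raising i j)
    (Y : Matrix (Fin n) (Fin n) ℂ) (hY : Y.IsSymm) (i j k l : Fin n) :
    ⁅⁅toUSp (lower Y hY), f (R i j)⁆, f (R k l)⁆ =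
      f (-(Y.map (algebraMap ℂ A) j k * R i l + Y.map (algebraMap ℂ A) i k * R j l
        + R k i * Y.map (algebraMap ℂ A) j l + R k j * Y.map (algebraMap ℂ A) i l)) := by
  have e : Y.map (algebraMap ℂ A) j k * R i l + Y.map (algebraMap ℂ A) i k * R j l
        + R k i * Y.map (algebraMap ℂ A) j l + R k j * Y.map (algebraMap ℂ A) i l =
      ∑ p, (symmUnit i j * Y) p k • R p l + ∑ p, (symmUnit i j * Y) p l • R k p := by
    simp only [symmUnit_mul_apply, add_smul, ite_smul, ← Algebra.smul_def, mul_comm (R k _),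
      zero_smul, Finset.sum_add_distrib,
      Finset.sum_ite_eq', Finset.mem_univ, if_true, map_apply]
    abel
  rw [hf, hf, lie_lower_raising, neg_lie, lie_levi_raising, e]
  simp only [map_neg, map_add, map_sum, map_smul, hf]

variable {V : Type*} [AddCommGroup V] [Module (USp n) V]

theorem HasWeight.raisingDet_smul {κ : ℂ} {v : V} (hf : ∀ i j, f (R i j) = raising i j)
    (hv : HasWeight (n := n) κ v) : HasWeight (n := n) (κ + 2) (f R.det • v) := by
  intro B
  have h := lie_levi_raisingDet f hf B
  rw [Ring.lie_def, sub_eq_iff_eq_add] at h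
  rw [← mul_smul, h, add_smul, mul_smul (f R.det), hv B, ← AlgHom.commutes f,
    ← AlgHom.commutes f, ← mul_smul, ← mul_smul, ← map_mul, ← map_mul, ← add_smul, ← map_add]
  congr 2
  simp only [map_mul, map_add, map_ofNat]
  ring

theorem lie_lower_raising_smul {κ : ℂ} {v : V} (hf : ∀ i j, f (R i j) = raising i j)
    (hv : HasWeight (n := n) κ v) (Y : Matrix (Fin n) (Fin n) ℂ) (hY : Y.IsSymm)
    (i j : Fin n) :
    ⁅toUSp (lower Y hY), f (R i j)⁆ • v =
      f (algebraMap ℂ A (-(2 * κ)) * Y.map (algebraMap ℂ A) i j) • v := by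
  rw [hf, lie_lower_raising, neg_smul, hv, ← neg_smul, ← map_neg, map_apply, ← map_mul,
    AlgHom.commutes]
  congr 2
  simp only [trace, diag_apply, symmUnit_mul_apply, Finset.sum_add_distrib, Finset.sum_ite_eq',
    Finset.mem_univ, if_true, hY.apply i j]
  ring

/-- The commutator of a lowering operator with `M̂₊`, applied to a vector of weight `κ`. The first
order part of the Leibniz rule gives the term with `κ`, and the double commutators give
`n - 1`. -/
theorem lie_lower_raisingDet_smul {κ : ℂ} {v : V} (hR : R.IsSymm)
    (hf : ∀ i j, f (R i j) = raising i j)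
    (hv : HasWeight (n := n) κ v) (Y : Matrix (Fin n) (Fin n) ℂ) (hY : Y.IsSymm) :
    ⁅toUSp (lower Y hY), f R.det⁆ • v =
      f (algebraMap ℂ A (n - 1 - 2 * κ) * (R.adjugate * Y.map (algebraMap ℂ A)).trace) • v := by
  set y : Matrix (Fin n) (Fin n) A := Y.map (algebraMap ℂ A)
  have hy : y.IsSymm := hY.map _
  set l := toUSp (lower Y hY)
  have key : ∀ σ : Equiv.Perm (Fin n), (2 * ⁅l, f (∏ a, R (σ a) a)⁆) • v =
      f (2 * (algebraMap ℂ A (-(2 * κ)) * ∑ a, y (σ a) a * ∏ i ∈ Finset.univ.erase a, R (σ i) i) +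
        ∑ a, ∑ b ∈ Finset.univ.erase a,
        (-(y a (σ b) * R (σ a) b + y (σ a) (σ b) * R a b + R (σ b) (σ a) * y a b
            + R (σ b) a * y (σ a) b) *
          ∏ i ∈ (Finset.univ.erase a).erase b, R (σ i) i)) • v := by
    intro σ
    have h := two_mul_lie_map_prod f.toRingHom l (fun a => R (σ a) a)
      (fun a b => -(y a (σ b) * R (σ a) b + y (σ a) (σ b) * R a b + R (σ b) (σ a) * y a b
            + R (σ b) a * y (σ a) b))
      (fun a b => lie_lie_lower_raising f hf Y hY _ _ _ _)
      (fun a b => by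
        simp only [hy.apply (σ a) (σ b), hy.apply a b, hR.apply a b, hR.apply (σ a) (σ b),
          hy.apply a (σ b), hy.apply b (σ a)]
        ring) Finset.univ
    have h' := congrArg (· • v) h
    simp only [AlgHom.toRingHom_eq_coe, RingHom.coe_coe] at h'
    rw [h', add_smul, map_add, add_smul]
    congr 1
    rw [mul_smul, map_mul, mul_smul, map_ofNat, Finset.sum_smul, Finset.mul_sum, map_sum,
      Finset.sum_smul]
    congr 1
    refine Finset.sum_congr rfl fun a _ => ?_
    rw [mul_smul, lie_lower_raising_smul f hf hv, ← mul_smul, ← map_mul]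
    congr 2
    ring
  have h2 : (2 : USp n) • (⁅l, f R.det⁆ • v) = (2 : USp n) •
      (f (algebraMap ℂ A (n - 1 - 2 * κ) * (R.adjugate * y).trace) • v) := by
    have e1 : (2 : USp n) * ⁅l, f R.det⁆ = ∑ σ : Equiv.Perm (Fin n),
        ((Equiv.Perm.sign σ : ℤˣ) : ℤ) • (2 * ⁅l, f (∏ a, R (σ a) a)⁆) := by
      rw [det_apply, map_sum, lie_sum, Finset.mul_sum]
      refine Finset.sum_congr rfl fun σ _ => ?_
      rw [Units.smul_def, map_zsmul, lie_zsmul, mul_smul_comm]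
    rw [← mul_smul, e1, Finset.sum_smul, Finset.sum_congr rfl fun σ _ => by
      rw [smul_assoc, key, ← smul_assoc, ← map_zsmul]]
    rw [← Finset.sum_smul, ← map_sum, ← map_ofNat f 2, ← mul_smul, ← map_mul]
    simp only [smul_add, Finset.sum_add_distrib, ← mul_smul_comm, ← Finset.mul_sum]
    rw [sum_sign_mul_pairs R y hR hy, ← trace_adjugate_mul_eq_sum]
    congr 2
    simp
    ring
  -- The factor `2` is invertible, since `V` is a complex vector space through `ℂ → U(sp(2n, ℂ))`.
  have h3 := congrArg (algebraMap ℂ (USp n) (1 / 2) • ·) h2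
  have h4 : algebraMap ℂ (USp n) (1 / 2) * 2 = 1 := by
    rw [← map_ofNat (algebraMap ℂ (USp n)) 2, ← map_mul]; norm_num
  simpa only [← mul_smul (algebraMap ℂ (USp n) (1 / 2)) (2 : USp n), h4, one_smul] using h3

theorem HasWeight.raisingDet_pow_smul {κ : ℂ} {v : V} (hf : ∀ i j, f (R i j) = raising i j)
    (hv : HasWeight (n := n) κ v) (k : ℕ) :
    HasWeight (n := n) (κ + 2 * k) (f (R.det ^ k) • v) := by
  induction k with
  | zero => simpa using hv
  | succ k ih =>
    rw [pow_succ', map_mul, mul_smul]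
    convert ih.raisingDet_smul f hf using 1
    push_cast; ring

/-- The action of lowering operators on `M̂₊ᵏ⁺¹ v`, for `v` holomorphic of weight `κ`. -/
theorem lower_smul_raisingDet_pow_smul {κ : ℂ} {v : V} (hR : R.IsSymm)
    (hf : ∀ i j, f (R i j) = raising i j) (hol : IsHol (n := n) v)
    (hv : HasWeight (n := n) κ v) (Y : Matrix (Fin n) (Fin n) ℂ) (hY : Y.IsSymm) (k : ℕ) :
    toUSp (lower Y hY) • f (R.det ^ (k + 1)) • v =
      f (algebraMap ℂ A ((k + 1) * (n - 1 - 2 * κ - 2 * k)) *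
        (R.adjugate * Y.map (algebraMap ℂ A)).trace * R.det ^ k) • v := by
  have step : ∀ w : V, toUSp (lower Y hY) • f R.det • w =
      ⁅toUSp (lower Y hY), f R.det⁆ • w + f R.det • toUSp (lower Y hY) • w := by
    intro w
    rw [Ring.lie_def, sub_smul, mul_smul, mul_smul, sub_add_cancel]
  induction k with
  | zero =>
    rw [zero_add, pow_one, step, hol Y hY, smul_zero, add_zero,
      lie_lower_raisingDet_smul f hR hf hv]
    simp
  | succ k ih =>
    rw [pow_succ' _ (k + 1), map_mul, mul_smul, step, ih,
      lie_lower_raisingDet_smul f hR hf (hv.raisingDet_pow_smul f hf (k + 1)), ← mul_smul,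
      ← mul_smul, ← map_mul, ← map_mul, ← add_smul, ← map_add]
    congr 2
    simp only [map_mul, map_sub, map_add, map_natCast, map_one, map_ofNat, Nat.cast_add,
      Nat.cast_one]
    ring

/-- If `C` denotes the adjugate of the matrix of raising operators and `tr(C Y) w = 0` for all
symmetric `Y`, then all entries of `C` annihilate `w`, and so does `M̂₊`, by expansion along a
row. -/
theorem raisingDet_smul_eq_zero (hn : 1 ≤ n) (hR : R.IsSymm) (w : V)
    (h : ∀ Y : Matrix (Fin n) (Fin n) ℂ, Y.IsSymm →
      f (R.adjugate * Y.map (algebraMap ℂ A)).trace • w = 0) :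
    f R.det • w = 0 := by
  have hadj : ∀ i j, f (R.adjugate i j) • w = 0 := by
    intro i j
    have hs : R.adjugate j i = R.adjugate i j := by
      conv_lhs => rw [← hR.eq, ← adjugate_transpose, transpose_apply]
    -- Halving compensates for the two equal contributions of `symmUnit i j`.
    have := h ((1 / 2 : ℂ) • symmUnit i j) ((symmUnit_isSymm i j).smul _)
    convert this using 2
    have hmap : ((1 / 2 : ℂ) • symmUnit i j).map (algebraMap ℂ A) =
        algebraMap ℂ A (1 / 2) • (Matrix.single i j 1 + Matrix.single j i 1) := by
      ext x y
      simp [symmUnit, Matrix.single_apply, apply_ite (algebraMap ℂ A), mul_add]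
    have h2 : algebraMap ℂ A (1 / 2) * 2 = 1 := by
      rw [← map_ofNat (algebraMap ℂ A) 2, ← map_mul]; norm_num
    rw [hmap, mul_smul_comm, mul_add, trace_smul, trace_add]
    simp only [trace_mul_single, smul_eq_mul, MulOpposite.op_one, one_smul, hs]
    rw [← two_mul, ← mul_assoc, h2, one_mul]
  have hdet : R.det = ∑ j, R ⟨0, hn⟩ j * R.adjugate j ⟨0, hn⟩ := by
    have := congrFun (congrFun (mul_adjugate R) ⟨0, hn⟩) ⟨0, hn⟩
    rw [Matrix.mul_apply] at this
    simp [this]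
  rw [hdet, map_sum, Finset.sum_smul]
  refine Finset.sum_eq_zero fun j _ => ?_
  rw [map_mul, mul_smul, hadj, smul_zero]

end Action

end SiegelSp

theorem mainTheorem1 (n : ℕ) (hn : 1 ≤ n) (r : ℕ)
    (V : Type*) [AddCommGroup V] [Module (SiegelSp.USp n) V] (v₀ : V)
    (hol : SiegelSp.IsHol (n := n) v₀)
    (wt : SiegelSp.HasWeight (n := n) (-(r : ℂ) + ((n : ℂ) - 1) / 2) v₀) :
    (SiegelSp.IsHol (n := n) (SiegelSp.raisingDet n ^ (r + 1) • v₀) ∧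
      SiegelSp.HasWeight (n := n) ((r : ℂ) + 2 + ((n : ℂ) - 1) / 2)
        (SiegelSp.raisingDet n ^ (r + 1) • v₀)) ∧
    ∀ k : ℕ, 1 ≤ k → k ≠ r + 1 → SiegelSp.raisingDet n ^ k • v₀ ≠ 0 →
      ¬ SiegelSp.IsHol (n := n) (SiegelSp.raisingDet n ^ k • v₀) := by
  obtain ⟨A, _, _, f, R, hR, hf⟩ := SiegelSp.exists_commutative_lift n
  have hM : ∀ k : ℕ, SiegelSp.raisingDet n ^ k = f (R.det ^ k) := fun k => by
    rw [SiegelSp.raisingDet_eq_map_det f.toRingHom R hf, map_pow]; rfl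
  have hlow := SiegelSp.lower_smul_raisingDet_pow_smul f hR hf hol wt
  simp only [hM]
  refine ⟨⟨fun Y hY => ?_, ?_⟩, fun k hk hkr hne hh => hne ?_⟩
  · rw [hlow]
    have : ((n : ℂ) - 1 - 2 * (-(r : ℂ) + ((n : ℂ) - 1) / 2) - 2 * r) = 0 := by ring
    simp [this]
  · convert wt.raisingDet_pow_smul f hf (r + 1) using 1
    push_cast; ring
  · obtain ⟨m, rfl⟩ := Nat.exists_eq_add_of_le' hk
    rw [pow_succ', map_mul, mul_smul]
    refine SiegelSp.raisingDet_smul_eq_zero f hn hR _ fun Y hY => ?_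
    have h0 := hh Y hY
    rw [hlow] at h0
    obtain ⟨c, hc⟩ : ∃ c : ℂ,
      c = (m + 1) * (n - 1 - 2 * (-(r : ℂ) + ((n : ℂ) - 1) / 2) - 2 * m) := ⟨_, rfl⟩
    have hc0 : c ≠ 0 := by
      have h1 : c = 2 * ((m + 1) * (r - m)) := by rw [hc]; ring
      rw [h1]
      refine mul_ne_zero two_ne_zero (mul_ne_zero (Nat.cast_add_one_ne_zero m) ?_)
      rw [sub_ne_zero]
      exact_mod_cast fun h : r = m => hkr (by rw [h])
    rw [← hc, mul_assoc, map_mul, mul_smul, AlgHom.commutes] at h0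
    have h1 := congrArg (algebraMap ℂ (SiegelSp.USp n) c⁻¹ • ·) h0
    simp only [smul_zero] at h1
    rwa [← mul_smul, ← map_mul, inv_mul_cancel₀ hc0, map_one, one_smul, map_mul, mul_smul] at h1
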